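/- For probability measures $P,Q$ on $\mathbb R$, let the trade-off function be $$T(P,Q)(\alpha)=\inf\bigl\{E_Q[1-\varphi]:\ \varphi:\mathbb R\to[0,1]\text{ measurable},\ E_P[\varphi]\le\alpha\bigr\},\qquad \alpha\in[0,1].$$ A benchmark trade-off function is a convex, continuous, non-increasing function $f:[0,1]\to[0,1]$ with $f(\alpha)\le 1-\alpha$ for all $\alpha\in[0,1]$; it is extended by $f(\alpha)=0$ for $\alpha>1$. Write $f\succeq g$ if $f(\alpha)\ge g(\alpha)$ for all $\alpha\in[0,1]$, and $f\not\succeq g$ otherwise. Let $\mathcal S=\{(-\infty,a),(a,+\infty):a\in\mathbb R\cup\{\pm\infty\}\}$. Let $\mathcal M_{\mathrm{MLR}}$ be the set of pairs $(P,Q)$ of continuous (atomless) probability measures on $\mathbb R$ whose likelihood ratio $dQ/dP=q/p\in[0,\infty]$, where $p,q$ are the densities of $P,Q$ with respect to $P+Q$, agrees $(P+Q)$-almost everywhere with a monotone (non-decreasing or non-increasing) function $\mathbb R\to[0,\infty]$. Let $n\ge1$, $\delta\in(0,1)$, $\eta=\sqrt{\frac1{2n}\log\frac4\delta}$, and let $f_0,f_1$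 be benchmark trade-off functions. From independent samples $X_1,\dots,X_n\sim P$ and $Y_1,\dots,Y_n\sim Q$ with empirical distributions $P_n,Q_n$, define the test $$\psi=\mathbf 1\bigl\{\exists\,S\in\mathcal S:\ Q_n(S^{c})+\eta<f_0\bigl(P_n(S)+\eta\bigr)\bigr\}.$$ **Theorem.** (i) Over all pairs of probability measures $P,Q$ on $\mathbb R$, $$\sup_{(P,Q):\,T(P,Q)\succeq f_0}(P^n\times Q^n)(\psi=1)\le\delta .$$ (ii) If $f_1(\alpha)\le\max\{f_0(\alpha+2\eta)-2\eta,\,0\}$ for all $\alpha\in[0,1]$, then $$\sup_{(P,Q)\in\mathcal M_{\mathrm{MLR}}:\,T(P,Q)\not\succeq f_1}(P^n\times Q^n)(\psi=0)\le\delta .$$ -/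

import Mathlib

open MeasureTheory

noncomputable section

namespace TradeoffTest

/-- The trade-off function of `P` and `Q`: the least type II error `E_Q[1 - φ]` over all measurable
randomized tests `φ` with values in `[0, 1]` whose type I error `E_P[φ]` is at most `α`. -/
def tradeoff {X : Type*} [MeasurableSpace X] (P Q : Measure X) (α : ℝ) : ℝ :=
  sInf {β : ℝ | ∃ φ : X → ℝ, Measurable φ ∧ (∀ x, φ x ∈ Set.Icc (0 : ℝ) 1) ∧
    ∫ x, φ x ∂P ≤ α ∧ β = ∫ x, (1 - φ x) ∂Q}

/-- Valid trade-off functions `[0, 1] → [0, 1]`: convex, continuous, non-increasing, and below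
`1 - α`. Only the values on `[0, 1]` matter; see `extend` for the values beyond `1`. -/
structure IsTradeoffFunction (f : ℝ → ℝ) : Prop where
  convex : ConvexOn ℝ (Set.Icc 0 1) f
  continuous : ContinuousOn f (Set.Icc 0 1)
  antitone : AntitoneOn f (Set.Icc 0 1)
  nonneg : ∀ α ∈ Set.Icc (0 : ℝ) 1, 0 ≤ f α
  le_one_sub : ∀ α ∈ Set.Icc (0 : ℝ) 1, f α ≤ 1 - α

/-- A benchmark on `[0, 1]`, extended by `0` beyond `1`. -/
def extend (f : ℝ → ℝ) (t : ℝ) : ℝ := if t ≤ 1 then f t else 0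

/-- `Dominates f g` is `f ⪰ g`: `f α ≥ g α` for all `α ∈ [0, 1]`. -/
def Dominates (f g : ℝ → ℝ) : Prop := ∀ α ∈ Set.Icc (0 : ℝ) 1, g α ≤ f α

/-- The joint law `Pⁿ × Qⁿ` of independent samples `X₁, …, Xₙ ∼ P` and `Y₁, …, Yₙ ∼ Q`. -/
def sampleLaw (n : ℕ) (P Q : ProbabilityMeasure ℝ) : Measure ((Fin n → ℝ) × (Fin n → ℝ)) :=
  (Measure.pi fun _ : Fin n => (P : Measure ℝ)).prod (Measure.pi fun _ : Fin n => (Q : Measure ℝ))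

/-- Worst-case type I error over the model `M`, under the null `T(P, Q) ⪰ f₀`, of the
(non-randomized) test with rejection region `R`. -/
def typeOneError {n : ℕ} (M : Set (ProbabilityMeasure ℝ × ProbabilityMeasure ℝ)) (f₀ : ℝ → ℝ)
    (R : Set ((Fin n → ℝ) × (Fin n → ℝ))) : ENNReal :=
  ⨆ (P : ProbabilityMeasure ℝ) (Q : ProbabilityMeasure ℝ) (_ : (P, Q) ∈ M)
    (_ : Dominates (tradeoff (P : Measure ℝ) (Q : Measure ℝ)) f₀), sampleLaw n P Q R

/-- Worst-case type II error over the model `M`, under the alternative that `T(P, Q) ⪰ f₁` fails,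
of the (non-randomized) test with rejection region `R`. -/
def typeTwoError {n : ℕ} (M : Set (ProbabilityMeasure ℝ × ProbabilityMeasure ℝ)) (f₁ : ℝ → ℝ)
    (R : Set ((Fin n → ℝ) × (Fin n → ℝ))) : ENNReal :=
  ⨆ (P : ProbabilityMeasure ℝ) (Q : ProbabilityMeasure ℝ) (_ : (P, Q) ∈ M)
    (_ : ¬ Dominates (tradeoff (P : Measure ℝ) (Q : Measure ℝ)) f₁), sampleLaw n P Q Rᶜ

/-- The likelihood ratio `dQ/dP = q / p` with values in `[0, ∞]`, where `p` and `q` are the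
densities of `P` and `Q` with respect to `P + Q`; it is `∞` where `p = 0 < q`, and `p = q = 0`
happens only on a null set of `P + Q`. -/
def likelihoodRatio (P Q : Measure ℝ) (x : ℝ) : ENNReal :=
  Q.rnDeriv (P + Q) x / P.rnDeriv (P + Q) x

/-- The continuous (atomless) pairs on `ℝ` with monotone likelihood ratio: some version of the
likelihood ratio is non-decreasing or non-increasing. -/
def mlrPairs : Set (ProbabilityMeasure ℝ × ProbabilityMeasure ℝ) :=
  {PQ | NullSingletonClass (PQ.1 : Measure ℝ) ∧ NullSingletonClass (PQ.2 : Measure ℝ) ∧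
    ∃ L : ℝ → ENNReal, (Monotone L ∨ Antitone L) ∧
      L =ᵐ[(PQ.1 : Measure ℝ) + (PQ.2 : Measure ℝ)]
        likelihoodRatio (PQ.1 : Measure ℝ) (PQ.2 : Measure ℝ)}

/-- The open half-lines `(-∞, a)` and `(a, +∞)`, with `a ∈ ℝ ∪ {±∞}`. -/
def halfLines : Set (Set ℝ) :=
  {S | ∃ a : EReal, S = {x : ℝ | (x : EReal) < a} ∨ S = {x : ℝ | a < (x : EReal)}}

/-- The empirical probability `(1/n) #{i : xᵢ ∈ S}`. -/
def empirical {n : ℕ} (x : Fin n → ℝ) (S : Set ℝ) : ℝ :=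
  (∑ i, S.indicator (fun _ => (1 : ℝ)) (x i)) / n

/-- The margin `η = √(log(4/δ) / (2n))`. -/
def margin (n : ℕ) (δ : ℝ) : ℝ := √(1 / (2 * n) * Real.log (4 / δ))

/-- Rejection region of the scan test over half-lines: some half-line `S` satisfies
`Qₙ(Sᶜ) + η < f₀(Pₙ(S) + η)`. -/
def scanTest (n : ℕ) (δ : ℝ) (f₀ : ℝ → ℝ) : Set ((Fin n → ℝ) × (Fin n → ℝ)) :=
  {xy | ∃ S ∈ halfLines,
    empirical xy.2 Sᶜ + margin n δ < extend f₀ (empirical xy.1 S + margin n δ)}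

end TradeoffTest

end

/-!
Everything rests on the one-sided Dvoretzky–Kiefer–Wolfowitz inequality with Massart's sharp
constant, `pi_iUnion_upperTailExcess_le`: the empirical measure of some half-line `[a, ∞)` exceeds
its `P`-measure by more than `ε` with probability at most `exp (-2nε²)`, for an arbitrary law `P`.
Applied to `P` and to its reflection it bounds the probability that the empirical measure deviates
by more than `ε` on some half-line by `2 exp (-2nε²)`, which is `δ / 2` at the margin `ε = η`.
So outside an event of probability `δ` both samples are uniformly `η`-accurate on half-lines
(`sampleLaw_le_of_subset_deviation`), and there both parts of the theorem are deterministic. Under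
the null, `f₀ (P S) ≤ Q Sᶜ` for every half-line `S`, so the test cannot reject. Under the
alternative, the Neyman–Pearson lemma turns a good randomized test into a half-line
(`exists_halfLine_mostPowerful`), and this half-line makes the scan test reject.

The sharp inequality is proved by a change of measure. For `C > 0` and `y = P [a, ∞)`, let
`tilt C P a` have density `(1 + C / y) / (1 + C)` with respect to `P` on `[a, ∞)` and `1 / (1 + C)`
below `a`. As `a` grows, the densities of the powers `(tilt C P a)ⁿ` form a martingale
(`map_min_tilt_eq`). Where the empirical measure of `[a, ∞)` exceeds `y + ε`, the density is at
least `exp (n ((y + ε) log (1 + C / y) - log (1 + C)))`. The maximal inequality therefore gives the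
bound once a single `C` makes this exponent at least `2nε²` for all `y` at once. Such a `C` exists
(`exists_tilt`): if `z` is a critical point of the binary relative entropy `kl (y + ε, y)`, take the
tilt that is optimal at `z`. The exponent is then minimal at `z` (`critical_point_le_exponent`),
where it equals `n kl (z + ε, z) ≥ 2nε²` by Pinsker's inequality.
-/

/-! ### The optimal exponential tilt -/

/-- Pinsker's inequality for two Bernoulli laws. -/
theorem two_mul_sq_sub_le_binary_kl {x y : ℝ} (hx₀ : 0 < x) (hx₁ : x < 1) (hy₀ : 0 < y)
    (hy₁ : y < 1) :
    2 * (x - y) ^ 2 ≤ x * (Real.log x - Real.log y)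
      + (1 - x) * (Real.log (1 - x) - Real.log (1 - y)) := by
  set g : ℝ → ℝ := fun y => x * (Real.log x - Real.log y)
      + (1 - x) * (Real.log (1 - x) - Real.log (1 - y)) - 2 * (x - y) ^ 2 with hg
  set g' : ℝ → ℝ := fun y => (y - x) * (1 / (y * (1 - y)) - 4) with hg'
  have hderiv : ∀ y, 0 < y → y < 1 → HasDerivAt g (g' y) y := by
    intro y h0 h1
    have e1 : HasDerivAt (fun y : ℝ => Real.log y) (y⁻¹) y := Real.hasDerivAt_log h0.ne'
    have e2 : HasDerivAt (fun y : ℝ => Real.log (1 - y)) (-1 / (1 - y)) y :=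
      ((hasDerivAt_id y).const_sub 1).log (by simp; linarith)
    have e3 : HasDerivAt (fun y : ℝ => 2 * (x - y) ^ 2) (2 * (2 * (x - y) * (-1))) y := by
      have := (((hasDerivAt_id y).const_sub x).pow 2).const_mul 2
      simpa using this
    refine HasDerivAt.congr_deriv (f := g) ((((e1.const_sub (Real.log x)).const_mul x).add
      ((e2.const_sub (Real.log (1 - x))).const_mul (1 - x))).sub e3) ?_
    simp only [hg']
    have : (1 - y) ≠ 0 := by linarith
    field_simp
    ring
  have hfac : ∀ y : ℝ, 0 < y → y < 1 → 0 ≤ 1 / (y * (1 - y)) - 4 := by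
    intro y h0 h1
    rw [sub_nonneg, le_div_iff₀ (mul_pos h0 (by linarith))]
    nlinarith [sq_nonneg (2 * y - 1)]
  have hgx : g x = 0 := by simp [hg]
  have hcont : ContinuousOn g (Set.Ioo 0 1) := fun z hz =>
    (hderiv z hz.1 hz.2).continuousAt.continuousWithinAt
  suffices h : 0 ≤ g y by simp only [hg] at h; linarith
  rcases le_total x y with hxy | hxy
  · have hm : MonotoneOn g (Set.Icc x y) := by
      refine monotoneOn_of_hasDerivWithinAt_nonneg (f' := g') (convex_Icc x y)
        (hcont.mono fun z hz => ⟨by linarith [hz.1], by linarith [hz.2]⟩) ?_ ?_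
      · intro z hz
        rw [interior_Icc] at hz
        exact (hderiv z (by linarith [hz.1]) (by linarith [hz.2])).hasDerivWithinAt
      · intro z hz
        rw [interior_Icc] at hz
        exact mul_nonneg (by linarith [hz.1]) (hfac z (by linarith [hz.1]) (by linarith [hz.2]))
    have := hm ⟨le_rfl, hxy⟩ ⟨hxy, le_rfl⟩ hxy
    linarith
  · have hm : AntitoneOn g (Set.Icc y x) := by
      refine antitoneOn_of_hasDerivWithinAt_nonpos (f' := g') (convex_Icc y x)
        (hcont.mono fun z hz => ⟨by linarith [hz.1], by linarith [hz.2]⟩) ?_ ?_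
      · intro z hz
        rw [interior_Icc] at hz
        exact (hderiv z (by linarith [hz.1]) (by linarith [hz.2])).hasDerivWithinAt
      · intro z hz
        rw [interior_Icc] at hz
        exact mul_nonpos_of_nonpos_of_nonneg (by linarith [hz.2])
          (hfac z (by linarith [hz.1]) (by linarith [hz.2]))
    have := hm ⟨le_rfl, hxy⟩ ⟨hxy, le_rfl⟩ hxy
    linarith

/-- The derivative of the exponent `(y + ε) log (1 + C / y)` in `y` is `C / (y (y + C))` times an
increasing function, so a critical point is a global minimum. -/
theorem critical_point_le_exponent {C ε z : ℝ} (hC : 0 < C) (hz : 0 < z)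
    (hcrit : z * (z + C) / C * (Real.log (z + C) - Real.log z) - z = ε) {y : ℝ} (hy : 0 < y) :
    (z + ε) * (Real.log (z + C) - Real.log z) ≤ (y + ε) * (Real.log (y + C) - Real.log y) := by
  set q : ℝ → ℝ := fun y => y * (y + C) / C * (Real.log (y + C) - Real.log y) - y with hq
  set f : ℝ → ℝ := fun y => (y + ε) * (Real.log (y + C) - Real.log y) with hf
  have hlog : ∀ y, 0 < y → HasDerivAt (fun y : ℝ => Real.log (y + C) - Real.log y)
      (1 / (y + C) - y⁻¹) y := fun y h0 =>
    (((hasDerivAt_id y).add_const C).log (by simp; linarith)).sub (Real.hasDerivAt_log h0.ne')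
  have hqd : ∀ y, 0 < y → HasDerivAt q
      ((2 * y + C) / C * (Real.log (y + C) - Real.log y) - 2) y := by
    intro y h0
    have e1 : HasDerivAt (fun y : ℝ => y * (y + C) / C) ((2 * y + C) / C) y := by
      refine HasDerivAt.congr_deriv
        (((hasDerivAt_id y).mul ((hasDerivAt_id y).add_const C)).div_const C) ?_
      simp only [id]
      ring
    refine HasDerivAt.congr_deriv (f := q) ((e1.mul (hlog y h0)).sub (hasDerivAt_id y)) ?_
    have : y + C ≠ 0 := by linarith
    field_simp
    ring
  have hqmono : MonotoneOn q (Set.Ioi 0) := by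
    refine monotoneOn_of_hasDerivWithinAt_nonneg (convex_Ioi 0)
      (fun z hz => (hqd z hz).continuousAt.continuousWithinAt) ?_ ?_
      (f' := fun y => (2 * y + C) / C * (Real.log (y + C) - Real.log y) - 2)
    · intro z hz
      rw [interior_Ioi] at hz
      exact (hqd z hz).hasDerivWithinAt
    · intro z hz
      rw [interior_Ioi] at hz
      have hz : 0 < z := hz
      have h1 := Real.le_log_one_add_of_nonneg (div_pos hC hz).le
      have h2 : Real.log (1 + C / z) = Real.log (z + C) - Real.log z := by
        rw [← Real.log_div (by linarith) hz.ne']; congr 1; field_simp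
      rw [h2] at h1
      have h3 : 2 * (C / z) / (C / z + 2) = 2 * C / (2 * z + C) := by field_simp; ring
      rw [h3] at h1
      have h4 : (2 * z + C) / C * (2 * C / (2 * z + C)) = 2 := by field_simp
      have h5 := mul_le_mul_of_nonneg_left h1 (show 0 ≤ (2 * z + C) / C by positivity)
      linarith
  have hfd : ∀ y, 0 < y → HasDerivAt f (C / (y * (y + C)) * (q y - ε)) y := by
    intro y h0
    refine HasDerivAt.congr_deriv (f := f) (((hasDerivAt_id y).add_const ε).mul (hlog y h0)) ?_
    have : y + C ≠ 0 := by linarith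
    simp only [hq, id]
    field_simp
    ring
  have hqz : q z = ε := hcrit
  change f z ≤ f y
  rcases le_total z y with h | h
  · have hm : MonotoneOn f (Set.Ici z) := by
      refine monotoneOn_of_hasDerivWithinAt_nonneg (convex_Ici z)
        (fun w hw => (hfd w (hz.trans_le hw)).continuousAt.continuousWithinAt)
        (f' := fun y => C / (y * (y + C)) * (q y - ε)) ?_ ?_
      · intro w hw
        rw [interior_Ici] at hw
        exact (hfd w (hz.trans hw)).hasDerivWithinAt
      · intro w hw
        rw [interior_Ici] at hw
        have hw0 : 0 < w := hz.trans hw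
        have := hqmono hz hw0 (le_of_lt hw)
        exact mul_nonneg (by positivity) (by linarith)
    exact hm (Set.mem_Ici.2 le_rfl) h h
  · have hm : AntitoneOn f (Set.Ioc 0 z) := by
      refine antitoneOn_of_hasDerivWithinAt_nonpos (convex_Ioc 0 z)
        (fun w hw => (hfd w hw.1).continuousAt.continuousWithinAt)
        (f' := fun y => C / (y * (y + C)) * (q y - ε)) ?_ ?_
      · intro w hw
        rw [interior_Ioc] at hw
        exact (hfd w hw.1).hasDerivWithinAt
      · intro w hw
        rw [interior_Ioc] at hw
        have hw0 : 0 < w := hw.1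
        have := hqmono hw0 hz hw.2.le
        exact mul_nonpos_of_nonneg_of_nonpos (by positivity) (by linarith)
    exact hm ⟨hy, h⟩ ⟨hz, le_rfl⟩ h

/-- The binary relative entropy `y ↦ kl (y + ε, y)` has a critical point; the equation says that
its derivative vanishes. -/
theorem exists_stationary {ε : ℝ} (h₀ : 0 < ε) (h₁ : ε < 1) :
    ∃ y, 0 < y ∧ y < 1 - ε ∧
      Real.log (y + ε) + Real.log (1 - y) - Real.log y - Real.log (1 - y - ε)
        = ε / (y * (1 - y)) := by
  set d : ℝ → ℝ := fun y => Real.log (y + ε) + Real.log (1 - y) - Real.log y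
    - Real.log (1 - y - ε) - ε / (y * (1 - y)) with hd
  have hcont : ContinuousOn d (Set.Ioo 0 (1 - ε)) := by
    intro y hy
    have a1 : y + ε ≠ 0 := by linarith [hy.1]
    have a2 : 1 - y ≠ 0 := by linarith [hy.2]
    have a3 : y ≠ 0 := hy.1.ne'
    have a4 : 1 - y - ε ≠ 0 := by linarith [hy.2]
    have a5 : y * (1 - y) ≠ 0 := mul_ne_zero a3 a2
    apply ContinuousAt.continuousWithinAt
    fun_prop (disch := assumption)
  -- At the midpoint `d ≤ 0` reads `log x ≤ (x - x⁻¹) / 2` with `x = (1 + ε) / (1 - ε)`, which is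
  -- `u ≤ sinh u` for `u = log x`.
  have hlo : d ((1 - ε) / 2) ≤ 0 := by
    have e1 : (1 - ε) / 2 + ε = (1 + ε) / 2 := by ring
    have e2 : 1 - (1 - ε) / 2 = (1 + ε) / 2 := by ring
    have e3 : (1 + ε) / 2 - ε = (1 - ε) / 2 := by ring
    have hx : 0 < (1 + ε) / (1 - ε) := div_pos (by linarith) (by linarith)
    have hm : (0 : ℝ) < 1 - ε := by linarith
    have hl := Real.self_le_sinh_iff.2 (Real.log_nonneg
      (show 1 ≤ (1 + ε) / (1 - ε) by rw [le_div_iff₀ hm]; linarith))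
    rw [Real.sinh_log hx] at hl
    have e4 : Real.log ((1 + ε) / (1 - ε))
        = Real.log ((1 + ε) / 2) - Real.log ((1 - ε) / 2) := by
      rw [← Real.log_div (by linarith) (by linarith)]; congr 1; field_simp
    have e5 : ((1 + ε) / (1 - ε) - ((1 + ε) / (1 - ε))⁻¹) / 2
        = ε / ((1 - ε) / 2 * ((1 + ε) / 2)) / 2 := by
      field_simp
      ring
    simp only [hd, e1, e2, e3]
    linarith
  have hlim : Filter.Tendsto d (nhdsWithin (1 - ε) (Set.Iio (1 - ε))) Filter.atTop := by
    have t1 : Filter.Tendsto (fun y => Real.log (y + ε) + Real.log (1 - y) - Real.log y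
        - ε / (y * (1 - y))) (nhdsWithin (1 - ε) (Set.Iio (1 - ε)))
        (nhds (Real.log (1 - ε + ε) + Real.log (1 - (1 - ε)) - Real.log (1 - ε)
          - ε / ((1 - ε) * (1 - (1 - ε))))) := by
      have a1 : 1 - ε + ε ≠ 0 := by linarith
      have a2 : 1 - (1 - ε) ≠ 0 := by linarith
      have a3 : 1 - ε ≠ 0 := by linarith
      have a5 : (1 - ε) * (1 - (1 - ε)) ≠ 0 := mul_ne_zero a3 a2
      apply ContinuousAt.continuousWithinAt
      fun_prop (disch := assumption)
    have t2 : Filter.Tendsto (fun y => -Real.log (1 - y - ε))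
        (nhdsWithin (1 - ε) (Set.Iio (1 - ε))) Filter.atTop := by
      refine Filter.tendsto_neg_atBot_atTop.comp
        (Real.tendsto_log_nhdsGT_zero.comp (tendsto_nhdsWithin_iff.2 ⟨?_, ?_⟩))
      · have : ContinuousAt (fun y : ℝ => 1 - y - ε) (1 - ε) := by fun_prop
        have h := this.continuousWithinAt (s := Set.Iio (1 - ε))
        simpa [ContinuousWithinAt] using h
      · filter_upwards [self_mem_nhdsWithin] with y hy
        have : y < 1 - ε := hy
        simp only [Set.mem_Ioi]
        linarith
    refine (t1.add_atTop t2).congr fun y => ?_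
    simp only [hd]
    ring
  have hmid : (1 - ε) / 2 < 1 - ε := by linarith
  obtain ⟨b, hb0, hb, hb1⟩ := ((hlim.eventually_ge_atTop 0).and
    ((eventually_nhdsWithin_of_eventually_nhds (lt_mem_nhds hmid)).and
      self_mem_nhdsWithin)).exists
  have hb1 : b < 1 - ε := hb1
  obtain ⟨y, hy, hy0⟩ := intermediate_value_Icc hb.le
    (hcont.mono fun z hz => ⟨by linarith [hz.1], by linarith [hz.2]⟩) ⟨hlo, hb0⟩
  refine ⟨y, by linarith [hy.1], by linarith [hy.2], ?_⟩
  simp only [hd] at hy0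
  linarith

/-- A single tilt `C` whose exponent is at least `2ε²` simultaneously for all `y > 0`. -/
theorem exists_tilt {ε : ℝ} (h₀ : 0 < ε) (h₁ : ε < 1) :
    ∃ C, 0 < C ∧ ∀ y, 0 < y →
      Real.log (1 + C) + 2 * ε ^ 2 ≤ (y + ε) * Real.log (1 + C / y) := by
  obtain ⟨z, hz, hz1, hcrit⟩ := exists_stationary h₀ h₁
  have hz' : 0 < 1 - z - ε := by linarith
  have hz2 : 0 < 1 - z := by linarith
  refine ⟨ε / (1 - z - ε), div_pos h₀ hz', fun y hy => ?_⟩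
  set C := ε / (1 - z - ε) with hC
  have hCpos : 0 < C := div_pos h₀ hz'
  have e1 : 1 + C = (1 - z) / (1 - z - ε) := by rw [hC]; field_simp; ring
  have e2 : z + C = (z + ε) * (1 - z) / (1 - z - ε) := by rw [hC]; field_simp; ring
  have e3 : Real.log (z + C) = Real.log (z + ε) + Real.log (1 - z) - Real.log (1 - z - ε) := by
    rw [e2, Real.log_div (by positivity) hz'.ne', Real.log_mul (by positivity) hz2.ne']
  have e4 : Real.log (1 + C) = Real.log (1 - z) - Real.log (1 - z - ε) := by
    rw [e1, Real.log_div hz2.ne' hz'.ne']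
  have e5 : Real.log (1 + C / y) = Real.log (y + C) - Real.log y := by
    rw [← Real.log_div (by positivity) hy.ne']; congr 1; field_simp
  have hkey := critical_point_le_exponent hCpos hz (ε := ε) (by
    have : Real.log (z + C) - Real.log z = ε / (z * (1 - z)) := by rw [e3]; linarith
    rw [this, e2, hC]
    field_simp
    ring) hy
  have hp := two_mul_sq_sub_le_binary_kl (x := z + ε) (y := z) (by linarith) (by linarith) hz
    (by linarith)
  have e6 : 1 - (z + ε) = 1 - z - ε := by ring
  rw [e6] at hp
  rw [e5, e4]
  refine le_trans ?_ hkey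
  rw [e3]
  nlinarith

/-! ### Change of measure and the maximal inequality -/

/-- Product densities: tilting each factor of a power `Pⁿ` by `g` tilts the power by
`∏ i, g (x i)`. -/
theorem pi_withDensity_eq_withDensity_prod {n : ℕ} (P : Measure ℝ) [IsProbabilityMeasure P]
    {g : ℝ → ENNReal} (hg : Measurable g) [SigmaFinite (P.withDensity g)] :
    (Measure.pi fun _ : Fin n => P.withDensity g)
      = (Measure.pi fun _ : Fin n => P).withDensity fun x => ∏ i, g (x i) := by
  refine Measure.pi_eq fun s hs => ?_
  rw [withDensity_apply _ (MeasurableSet.univ_pi hs),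
    ← lintegral_indicator (MeasurableSet.univ_pi hs)]
  have h : ∀ x : Fin n → ℝ, (Set.univ.pi s).indicator (fun x => ∏ i, g (x i)) x
      = ∏ i, (s i).indicator g (x i) := by
    intro x
    by_cases hx : x ∈ Set.univ.pi s
    · rw [Set.indicator_of_mem hx]
      exact Finset.prod_congr rfl fun i _ => (Set.indicator_of_mem (hx i trivial) g).symm
    · rw [Set.indicator_of_notMem hx]
      obtain ⟨i, hi⟩ : ∃ i, x i ∉ s i := by simpa [Set.mem_pi] using hx
      exact (Finset.prod_eq_zero (Finset.mem_univ i) (Set.indicator_of_notMem hi g)).symm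
  simp_rw [h]
  have hind : ProbabilityTheory.iIndepFun
      (fun i (x : Fin n → ℝ) => (s i).indicator g (x i)) (Measure.pi fun _ : Fin n => P) :=
    ProbabilityTheory.iIndepFun_pi (X := fun i => (s i).indicator g)
      fun i => (hg.indicator (hs i)).aemeasurable
  rw [ProbabilityTheory.lintegral_prod_eq_prod_lintegral_of_indepFun Finset.univ _ hind
    fun i => (hg.indicator (hs i)).comp (measurable_pi_apply i)]
  refine Finset.prod_congr rfl fun i _ => ?_
  rw [(measurePreserving_eval (fun _ : Fin n => P) i).lintegral_comp (hg.indicator (hs i)),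
    lintegral_indicator (hs i), withDensity_apply _ (hs i)]

/-- The density of `tilt C P a` with respect to `P`. -/
noncomputable def tiltDensity (C : ℝ) (P : Measure ℝ) (a x : ℝ) : ENNReal :=
  ENNReal.ofReal (1 / (1 + C))
    + (Set.Ici a).indicator (fun _ => ENNReal.ofReal (C / P.real (Set.Ici a) / (1 + C))) x

/-- The mixture of `P` and of `P` conditioned on `[a, ∞)`, with weights proportional to `1` and
`C`. It is a probability measure as soon as `P [a, ∞) > 0`. -/
noncomputable def tilt (C : ℝ) (P : Measure ℝ) (a : ℝ) : Measure ℝ := P.withDensity (tiltDensity C P a)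

theorem measurable_tiltDensity (C : ℝ) (P : Measure ℝ) (a : ℝ) :
    Measurable (tiltDensity C P a) := by
  have h : Measurable ((Set.Ici a).indicator
      fun _ : ℝ => ENNReal.ofReal (C / P.real (Set.Ici a) / (1 + C))) :=
    measurable_const.indicator measurableSet_Ici
  exact h.const_add _

theorem isProbabilityMeasure_tilt {C : ℝ} (hC : 0 < C) (P : Measure ℝ) [IsProbabilityMeasure P]
    {a : ℝ} (ha : 0 < P.real (Set.Ici a)) : IsProbabilityMeasure (tilt C P a) := by
  constructor
  rw [tilt, withDensity_apply _ MeasurableSet.univ, Measure.restrict_univ]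
  simp only [tiltDensity]
  rw [lintegral_add_left measurable_const, lintegral_indicator measurableSet_Ici]
  simp only [lintegral_const, measure_univ, mul_one, Measure.restrict_apply MeasurableSet.univ,
    Set.univ_inter]
  rw [← ENNReal.ofReal_toReal (measure_ne_top P (Set.Ici a))]
  change _ + _ * ENNReal.ofReal (P.real (Set.Ici a)) = 1
  rw [← ENNReal.ofReal_mul (by positivity), ← ENNReal.ofReal_add (by positivity) (by positivity),
    ← ENNReal.ofReal_one]
  congr 1
  field_simp

theorem tilt_apply_of_subset_Iio {C : ℝ} (P : Measure ℝ) {a : ℝ} {T : Set ℝ}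
    (hT : MeasurableSet T) (h : T ⊆ Set.Iio a) :
    tilt C P a T = ENNReal.ofReal (1 / (1 + C)) * P T := by
  rw [tilt, withDensity_apply _ hT]
  rw [setLIntegral_congr_fun (g := fun _ => ENNReal.ofReal (1 / (1 + C))) hT]
  · simp
  · intro x hx
    have : x ∉ Set.Ici a := by simpa using h hx
    simp [tiltDensity, Set.indicator_of_notMem this]

/-- Tilting at a later threshold `b` does not change what is seen before `a`: this is the
martingale property of the tilting densities. -/
theorem map_min_tilt_eq {C : ℝ} (hC : 0 < C) (P : Measure ℝ) [IsProbabilityMeasure P] {a b : ℝ}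
    (hab : a ≤ b) (hb : 0 < P.real (Set.Ici b)) :
    (tilt C P a).map (fun x => min x a) = (tilt C P b).map (fun x => min x a) := by
  have ha : 0 < P.real (Set.Ici a) := hb.trans_le (measureReal_mono (Set.Ici_subset_Ici.2 hab))
  have := isProbabilityMeasure_tilt hC P ha
  have := isProbabilityMeasure_tilt hC P hb
  have hIio : ∀ T, MeasurableSet T → T ⊆ Set.Iio a → tilt C P a T = tilt C P b T := by
    intro T hT h
    rw [tilt_apply_of_subset_Iio P hT h,
      tilt_apply_of_subset_Iio P hT (h.trans (Set.Iio_subset_Iio hab))]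
  have hIci : tilt C P a (Set.Ici a) = tilt C P b (Set.Ici a) := by
    rw [← Set.compl_Iio, prob_compl_eq_one_sub measurableSet_Iio,
      prob_compl_eq_one_sub measurableSet_Iio, hIio _ measurableSet_Iio subset_rfl]
  have hmin : Measurable fun x : ℝ => min x a := measurable_id.min measurable_const
  ext B hB
  rw [Measure.map_apply hmin hB, Measure.map_apply hmin hB,
    ← measure_inter_add_sdiff _ (measurableSet_Iio (a := a)),
    ← measure_inter_add_sdiff (μ := tilt C P b) _ (measurableSet_Iio (a := a)),
    hIio _ ((hmin hB).inter measurableSet_Iio) Set.inter_subset_right]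
  congr 1
  by_cases haB : a ∈ B
  · have : (fun x => min x a) ⁻¹' B \ Set.Iio a = Set.Ici a := by
      ext x
      simp only [Set.mem_sdiff, Set.mem_preimage, Set.mem_Iio, not_lt, Set.mem_Ici]
      exact ⟨fun h => h.2, fun h => ⟨by rwa [min_eq_right h], h⟩⟩
    rw [this, hIci]
  · have : (fun x => min x a) ⁻¹' B \ Set.Iio a = ∅ := by
      ext x
      simp only [Set.mem_sdiff, Set.mem_preimage, Set.mem_Iio, not_lt, Set.mem_empty_iff_false,
        iff_false, not_and]
      exact fun h h' => haB (by rwa [min_eq_right h'] at h)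
    rw [this]
    simp

namespace TradeoffTest

/-- The samples whose empirical measure exceeds `P` on `[a, ∞)` by more than `ε`. -/
def upperTailExcess (n : ℕ) (P : Measure ℝ) (ε a : ℝ) : Set (Fin n → ℝ) :=
  {x | P.real (Set.Ici a) + ε < empirical x (Set.Ici a)}

theorem measurable_empirical {n : ℕ} {S : Set ℝ} (hS : MeasurableSet S) :
    Measurable fun x : Fin n → ℝ => empirical x S := by
  unfold empirical
  refine Measurable.div_const (Finset.measurable_sum _ fun i _ => ?_) _
  exact (measurable_const.indicator hS).comp (measurable_pi_apply i)

theorem measurableSet_upperTailExcess (n : ℕ) (P : Measure ℝ) (ε a : ℝ) :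
    MeasurableSet (upperTailExcess n P ε a) :=
  measurableSet_lt measurable_const (measurable_empirical measurableSet_Ici)

theorem min_mem_upperTailExcess_iff {n : ℕ} {P : Measure ℝ} {ε a b : ℝ} (hab : a ≤ b)
    (x : Fin n → ℝ) :
    (fun i => min (x i) b) ∈ upperTailExcess n P ε a ↔ x ∈ upperTailExcess n P ε a := by
  have : empirical (fun i => min (x i) b) (Set.Ici a) = empirical x (Set.Ici a) := by
    unfold empirical
    congr 1
    refine Finset.sum_congr rfl fun i _ => ?_
    have : min (x i) b ∈ Set.Ici a ↔ x i ∈ Set.Ici a := by simp [hab]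
    by_cases h : x i ∈ Set.Ici a
    · rw [Set.indicator_of_mem h, Set.indicator_of_mem (this.2 h)]
    · rw [Set.indicator_of_notMem h, Set.indicator_of_notMem (mt this.1 h)]
  simp only [upperTailExcess, Set.mem_ofPred_eq, this]

/-- On `upperTailExcess n P ε a` the density of `(tilt C P a)ⁿ` is at least `exp (2nε²)`. -/
theorem exp_mul_pi_le_pi_tilt {n : ℕ} (hn : 1 ≤ n) {C ε : ℝ} (hC : 0 < C)
    (hCε : ∀ y, 0 < y → Real.log (1 + C) + 2 * ε ^ 2 ≤ (y + ε) * Real.log (1 + C / y))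
    (P : Measure ℝ) [IsProbabilityMeasure P] {a : ℝ} (ha : 0 < P.real (Set.Ici a))
    {A : Set (Fin n → ℝ)} (hA : MeasurableSet A) (hAe : A ⊆ upperTailExcess n P ε a) :
    ENNReal.ofReal (Real.exp (2 * n * ε ^ 2)) * (Measure.pi fun _ : Fin n => P) A
      ≤ (Measure.pi fun _ : Fin n => tilt C P a) A := by
  have hprob := isProbabilityMeasure_tilt hC P ha
  set y := P.real (Set.Ici a) with hy
  have : SigmaFinite (P.withDensity (tiltDensity C P a)) := by
    change SigmaFinite (tilt C P a); infer_instance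
  unfold tilt
  rw [pi_withDensity_eq_withDensity_prod P (measurable_tiltDensity C P a), withDensity_apply _ hA,
    ← setLIntegral_const]
  refine setLIntegral_mono' hA fun x hx => ?_
  have hx : y + ε < empirical x (Set.Ici a) := hAe hx
  have hn0 : (0 : ℝ) < n := by exact_mod_cast hn
  have hfac : ∀ i, tiltDensity C P a (x i) = ENNReal.ofReal (Real.exp
      (-Real.log (1 + C) + (Set.Ici a).indicator (fun _ => (1 : ℝ)) (x i)
        * Real.log (1 + C / y))) := by
    intro i
    have h1 : Real.exp (-Real.log (1 + C)) = 1 / (1 + C) := by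
      rw [Real.exp_neg, Real.exp_log (by linarith), one_div]
    have h2 : Real.exp (Real.log (1 + C / y)) = 1 + C / y := Real.exp_log (by positivity)
    rw [tiltDensity]
    by_cases h : x i ∈ Set.Ici a
    · rw [Set.indicator_of_mem h, Set.indicator_of_mem h, one_mul, Real.exp_add, h1, h2,
        ← ENNReal.ofReal_add (by positivity) (by positivity)]
      congr 1
      ring
    · rw [Set.indicator_of_notMem h, Set.indicator_of_notMem h]
      simp [h1]
  simp_rw [hfac]
  rw [← ENNReal.ofReal_prod_of_nonneg fun i _ => (Real.exp_pos _).le, ← Real.exp_sum]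
  refine ENNReal.ofReal_le_ofReal (Real.exp_le_exp.2 ?_)
  rw [Finset.sum_add_distrib, ← Finset.sum_mul]
  have hsum : ∑ i, (Set.Ici a).indicator (fun _ => (1 : ℝ)) (x i)
      = n * empirical x (Set.Ici a) := by
    unfold empirical; field_simp
  rw [hsum]
  simp only [Finset.sum_const, Finset.card_univ, Fintype.card_fin, nsmul_eq_mul]
  have hlog : 0 ≤ Real.log (1 + C / y) :=
    Real.log_nonneg (by linarith [div_pos hC ha])
  have h1 := mul_le_mul_of_nonneg_right hx.le hlog
  have h2 := hCε y ha
  have h3 := mul_le_mul_of_nonneg_left (h2.trans h1) hn0.le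
  linarith

/-- Maximal inequality over finitely many thresholds. The part of the union that is new at the
threshold `c` is charged to `(tilt C P c)ⁿ`; by `map_min_tilt_eq`, moving on to a later threshold
`b` leaves the charges made so far unchanged. -/
theorem exp_mul_pi_biUnion_le_pi_tilt {n : ℕ} (hn : 1 ≤ n) {C ε : ℝ} (hC : 0 < C)
    (hCε : ∀ y, 0 < y → Real.log (1 + C) + 2 * ε ^ 2 ≤ (y + ε) * Real.log (1 + C / y))
    (P : Measure ℝ) [IsProbabilityMeasure P] (s : Finset ℝ) :
    ∀ b, (∀ a ∈ s, a ≤ b) → 0 < P.real (Set.Ici b) →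
      ENNReal.ofReal (Real.exp (2 * n * ε ^ 2))
          * (Measure.pi fun _ : Fin n => P) (⋃ a ∈ s, upperTailExcess n P ε a)
        ≤ (Measure.pi fun _ : Fin n => tilt C P b) (⋃ a ∈ s, upperTailExcess n P ε a) := by
  induction s using Finset.induction_on_max with
  | empty => simp
  | insert c s hcs ih =>
    intro b hb hPb
    have hcb : c ≤ b := hb c (Finset.mem_insert_self c s)
    have hPc : 0 < P.real (Set.Ici c) :=
      hPb.trans_le (measureReal_mono (Set.Ici_subset_Ici.2 hcb))
    have := isProbabilityMeasure_tilt hC P hPb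
    have := isProbabilityMeasure_tilt hC P hPc
    set U : Finset ℝ → Set (Fin n → ℝ) := fun s => ⋃ a ∈ s, upperTailExcess n P ε a with hU
    have hUm : ∀ s, MeasurableSet (U s) := fun s =>
      s.measurableSet_biUnion fun a _ => measurableSet_upperTailExcess n P ε a
    have hins : U (insert c s) = U s ∪ (upperTailExcess n P ε c \ U s) := by
      simp only [hU, Finset.set_biUnion_insert, Set.union_sdiff_self]
      exact Set.union_comm _ _
    have hinv : (Measure.pi fun _ : Fin n => tilt C P b) (U (insert c s))
        = (Measure.pi fun _ : Fin n => tilt C P c) (U (insert c s)) := by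
      have hmin : Measurable fun x : ℝ => min x c := measurable_id.min measurable_const
      have hpre : (fun (x : Fin n → ℝ) i => min (x i) c) ⁻¹' U (insert c s)
          = U (insert c s) := by
        ext x
        simp only [hU, Set.mem_preimage, Set.mem_iUnion]
        refine exists_congr fun a => exists_congr fun ha => min_mem_upperTailExcess_iff ?_ x
        rcases Finset.mem_insert.1 ha with rfl | h
        · exact le_rfl
        · exact (hcs a h).le
      have hpim : Measurable fun (x : Fin n → ℝ) i => min (x i) c :=
        measurable_pi_lambda _ fun i => hmin.comp (measurable_pi_apply i)
      have key : ∀ μ : Measure ℝ, IsProbabilityMeasure μ →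
          (Measure.pi fun _ : Fin n => μ) (U (insert c s))
            = (Measure.pi fun _ : Fin n => μ.map fun x => min x c) (U (insert c s)) := by
        intro μ hμ
        have := Measure.isProbabilityMeasure_map (μ := μ) hmin.aemeasurable
        rw [← Measure.pi_map_pi (fun _ => hmin.aemeasurable), Measure.map_apply hpim (hUm _), hpre]
      rw [key _ inferInstance, key (tilt C P c) inferInstance, map_min_tilt_eq hC P hcb hPb]
    change _ * (Measure.pi fun _ : Fin n => P) (U (insert c s)) ≤ _
    change _ ≤ (Measure.pi fun _ : Fin n => tilt C P b) (U (insert c s))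
    rw [hinv, hins]
    have hd : Disjoint (U s) (upperTailExcess n P ε c \ U s) := Set.disjoint_sdiff_right
    have hm := (measurableSet_upperTailExcess n P ε c).diff (hUm s)
    rw [measure_union hd hm, measure_union hd hm, mul_add]
    exact add_le_add (ih c (fun a ha => (hcs a ha).le) hPc)
      (exp_mul_pi_le_pi_tilt hn hC hCε P hPc hm Set.sdiff_subset)

end TradeoffTest

/-! ### The Dvoretzky–Kiefer–Wolfowitz–Massart inequality on half-lines -/

namespace TradeoffTest

theorem empirical_nonneg {n : ℕ} (x : Fin n → ℝ) (S : Set ℝ) : 0 ≤ empirical x S := by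
  unfold empirical
  exact div_nonneg (Finset.sum_nonneg fun i _ => Set.indicator_nonneg (fun _ _ => zero_le_one) _)
    (Nat.cast_nonneg n)

theorem empirical_le_empirical {n : ℕ} {x : Fin n → ℝ} {S T : Set ℝ}
    (h : ∀ i, x i ∈ S → x i ∈ T) : empirical x S ≤ empirical x T := by
  unfold empirical
  refine div_le_div_of_nonneg_right (Finset.sum_le_sum fun i _ => ?_) (Nat.cast_nonneg n)
  by_cases hi : x i ∈ S
  · rw [Set.indicator_of_mem hi, Set.indicator_of_mem (h i hi)]
  · rw [Set.indicator_of_notMem hi]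
    exact Set.indicator_nonneg (fun _ _ => zero_le_one) _

theorem empirical_univ {n : ℕ} (hn : 1 ≤ n) (x : Fin n → ℝ) : empirical x Set.univ = 1 := by
  have : (n : ℝ) ≠ 0 := by positivity
  simp [empirical, this]

theorem empirical_empty {n : ℕ} (x : Fin n → ℝ) : empirical x ∅ = 0 := by
  simp [empirical]

theorem empirical_compl {n : ℕ} (hn : 1 ≤ n) (x : Fin n → ℝ) (S : Set ℝ) :
    empirical x Sᶜ = 1 - empirical x S := by
  have h : empirical x S + empirical x Sᶜ = empirical x Set.univ := by
    unfold empirical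
    rw [← add_div, ← Finset.sum_add_distrib]
    congr 1
    refine Finset.sum_congr rfl fun i _ => ?_
    by_cases hi : x i ∈ S <;> simp [hi]
  rw [empirical_univ hn] at h
  linarith

theorem empirical_le_one {n : ℕ} (hn : 1 ≤ n) (x : Fin n → ℝ) (S : Set ℝ) :
    empirical x S ≤ 1 :=
  (empirical_le_empirical fun _ _ => Set.mem_univ _).trans (empirical_univ hn x).le

theorem exists_mem_of_empirical_pos {n : ℕ} {x : Fin n → ℝ} {S : Set ℝ}
    (h : 0 < empirical x S) : ∃ i, x i ∈ S := by
  by_contra! hS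
  have := empirical_le_empirical (x := x) (S := S) (T := ∅) fun i hi => (hS i hi).elim
  rw [empirical_empty] at this
  linarith

theorem pi_biUnion_upperTailExcess_le {n : ℕ} (hn : 1 ≤ n) {ε : ℝ} (h₀ : 0 < ε) (h₁ : ε < 1)
    (P : Measure ℝ) [IsProbabilityMeasure P] (s : Finset ℝ)
    (hs : ∀ a ∈ s, 0 < P.real (Set.Ici a)) :
    (Measure.pi fun _ : Fin n => P) (⋃ a ∈ s, upperTailExcess n P ε a)
      ≤ ENNReal.ofReal (Real.exp (-(2 * n * ε ^ 2))) := by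
  rcases s.eq_empty_or_nonempty with rfl | hne
  · simp
  obtain ⟨C, hC, hCε⟩ := exists_tilt h₀ h₁
  have hP := hs _ (s.max'_mem hne)
  have := isProbabilityMeasure_tilt hC P hP
  have h := (exp_mul_pi_biUnion_le_pi_tilt hn hC hCε P s (s.max' hne)
    (fun a ha => s.le_max' a ha) hP).trans prob_le_one
  rw [Real.exp_neg, ENNReal.ofReal_inv_of_pos (Real.exp_pos _)]
  exact ENNReal.le_inv_iff_mul_le.2 (by rwa [mul_comm])

/-- Since `P [q, ∞)` tends to `P [a, ∞)` as `q` increases to `a`, rational thresholds suffice in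
suprema over `a`, also when `P` has atoms. -/
theorem exists_rat_lt_real_Ici_lt (P : Measure ℝ) [IsProbabilityMeasure P] {a t : ℝ}
    (h : P.real (Set.Ici a) < t) : ∃ q : ℚ, (q : ℝ) < a ∧ P.real (Set.Ici (q : ℝ)) < t := by
  obtain ⟨u, hu, hlt, hlim⟩ := Real.exists_seq_rat_strictMono_tendsto a
  have hI : ⋂ k, Set.Ici (u k : ℝ) = Set.Ici a := by
    ext z
    simp only [Set.mem_iInter, Set.mem_Ici]
    exact ⟨fun hz => le_of_tendsto' hlim hz, fun hz k => (hlt k).le.trans hz⟩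
  have ht : Filter.Tendsto (fun k => P (Set.Ici (u k : ℝ))) Filter.atTop
      (nhds (P (Set.Ici a))) := by
    rw [← hI]
    refine tendsto_measure_iInter_atTop (fun k => measurableSet_Ici.nullMeasurableSet) ?_
      ⟨0, measure_ne_top _ _⟩
    intro i j hij
    exact Set.Ici_subset_Ici.2 (by exact_mod_cast hu.monotone hij)
  have ht' := (ENNReal.tendsto_toReal (measure_ne_top P (Set.Ici a))).comp ht
  obtain ⟨k, hk⟩ := (ht'.eventually (gt_mem_nhds h)).exists
  exact ⟨u k, hlt k, hk⟩

/-- One-sided Dvoretzky–Kiefer–Wolfowitz–Massart inequality, for closed upper half-lines and an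
arbitrary law `P`. -/
theorem pi_iUnion_upperTailExcess_le {n : ℕ} (hn : 1 ≤ n) {ε : ℝ} (h₀ : 0 < ε)
    (P : Measure ℝ) [IsProbabilityMeasure P] :
    (Measure.pi fun _ : Fin n => P) (⋃ a, upperTailExcess n P ε a)
      ≤ ENNReal.ofReal (Real.exp (-(2 * n * ε ^ 2))) := by
  rcases le_or_gt 1 ε with h₁ | h₁
  · have : ⋃ a, upperTailExcess n P ε a = ∅ := by
      refine Set.iUnion_eq_empty.2 fun a => Set.eq_empty_of_forall_notMem fun x hx => ?_
      have hx : P.real (Set.Ici a) + ε < empirical x (Set.Ici a) := hx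
      have := empirical_le_one hn x (Set.Ici a)
      have := measureReal_nonneg (μ := P) (s := Set.Ici a)
      linarith
    rw [this]
    simp
  set ι := {q : ℚ // 0 < P.real (Set.Ici (q : ℝ))} with hι
  set N : Set (Fin n → ℝ) := ⋃ (i : Fin n) (q : {q : ℚ // P (Set.Ici (q : ℝ)) = 0}),
    (fun x => x i) ⁻¹' Set.Ici ((q : ℚ) : ℝ) with hN
  have hN0 : (Measure.pi fun _ : Fin n => P) N = 0 := by
    refine measure_iUnion_null fun i => measure_iUnion_null fun q => ?_
    exact (Measure.quasiMeasurePreserving_eval (fun _ : Fin n => P) i).preimage_null q.2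
  -- The tilts are available only where `P [q, ∞) > 0`; the other thresholds are almost surely not
  -- reached by any sample point.
  have hsub : ⋃ a, upperTailExcess n P ε a
      ⊆ (⋃ s : Finset ι, ⋃ q ∈ s, upperTailExcess n P ε ((q : ℚ) : ℝ)) ∪ N := by
    intro x hx
    obtain ⟨a, hx⟩ := Set.mem_iUnion.1 hx
    have hx : P.real (Set.Ici a) + ε < empirical x (Set.Ici a) := hx
    obtain ⟨q, hqa, hq⟩ := exists_rat_lt_real_Ici_lt P (lt_sub_iff_add_lt.2 hx)
    have hle : empirical x (Set.Ici a) ≤ empirical x (Set.Ici (q : ℝ)) :=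
      empirical_le_empirical fun i hi => Set.Ici_subset_Ici.2 hqa.le hi
    rcases (measureReal_nonneg (μ := P) (s := Set.Ici (q : ℝ))).lt_or_eq with hpos | h0
    · left
      refine Set.mem_iUnion.2 ⟨{⟨q, hpos⟩}, ?_⟩
      simp only [Finset.mem_singleton, Set.iUnion_iUnion_eq_left]
      change P.real (Set.Ici (q : ℝ)) + ε < empirical x (Set.Ici (q : ℝ))
      linarith
    · right
      obtain ⟨i, hi⟩ := exists_mem_of_empirical_pos
        (x := x) (S := Set.Ici (q : ℝ)) (by linarith)
      have hq0 : P (Set.Ici (q : ℝ)) = 0 :=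
        (measureReal_eq_zero_iff (measure_ne_top _ _)).1 h0.symm
      exact Set.mem_iUnion.2 ⟨i, Set.mem_iUnion.2 ⟨⟨q, hq0⟩, hi⟩⟩
  refine (measure_mono hsub).trans ((measure_union_le _ _).trans ?_)
  rw [hN0, add_zero, Directed.measure_iUnion]
  · refine iSup_le fun s => ?_
    have := pi_biUnion_upperTailExcess_le hn h₀ h₁ P
      (s.image fun q : ι => ((q : ℚ) : ℝ)) (by
        intro a ha
        obtain ⟨q, -, rfl⟩ := Finset.mem_image.1 ha
        exact q.2)
    rwa [Finset.set_biUnion_finset_image] at this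
  · classical
    exact directed_of_isDirected_le fun s t hst => Set.biUnion_subset_biUnion_left hst

/-- The samples whose empirical measure exceeds `P` on `(-∞, a]` by more than `ε`. -/
def lowerTailExcess (n : ℕ) (P : Measure ℝ) (ε a : ℝ) : Set (Fin n → ℝ) :=
  {x | P.real (Set.Iic a) + ε < empirical x (Set.Iic a)}

theorem pi_iUnion_lowerTailExcess_le {n : ℕ} (hn : 1 ≤ n) {ε : ℝ} (h₀ : 0 < ε)
    (P : Measure ℝ) [IsProbabilityMeasure P] :
    (Measure.pi fun _ : Fin n => P) (⋃ a, lowerTailExcess n P ε a)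
      ≤ ENNReal.ofReal (Real.exp (-(2 * n * ε ^ 2))) := by
  have hneg : Measurable fun x : ℝ => -x := measurable_neg
  have := Measure.isProbabilityMeasure_map (μ := P) hneg.aemeasurable
  have h := pi_iUnion_upperTailExcess_le hn h₀ (P.map fun x => -x)
  have hpim : Measurable fun (x : Fin n → ℝ) i => -x i :=
    measurable_pi_lambda _ fun i => hneg.comp (measurable_pi_apply i)
  rw [← Measure.pi_map_pi (fun _ => hneg.aemeasurable)] at h
  refine le_trans ?_ ((Measure.le_map_apply hpim.aemeasurable _).trans h)
  refine measure_mono fun x hx => ?_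
  obtain ⟨a, hx⟩ := Set.mem_iUnion.1 hx
  have hx : P.real (Set.Iic a) + ε < empirical x (Set.Iic a) := hx
  refine Set.mem_iUnion.2 ⟨-a, ?_⟩
  change (P.map fun x => -x).real (Set.Ici (-a)) + ε < empirical (fun i => -x i) (Set.Ici (-a))
  rw [map_measureReal_apply hneg measurableSet_Ici]
  have h1 : (fun x : ℝ => -x) ⁻¹' Set.Ici (-a) = Set.Iic a := by ext z; simp
  have h2 : empirical x (Set.Iic a) ≤ empirical (fun i => -x i) (Set.Ici (-a)) := by
    unfold empirical
    refine div_le_div_of_nonneg_right (Finset.sum_le_sum fun i _ => ?_) (Nat.cast_nonneg n)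
    have hi : x i ∈ Set.Iic a ↔ -x i ∈ Set.Ici (-a) := by simp
    by_cases h : x i ∈ Set.Iic a
    · rw [Set.indicator_of_mem h, Set.indicator_of_mem (hi.1 h)]
    · rw [Set.indicator_of_notMem h, Set.indicator_of_notMem (mt hi.2 h)]
  rw [h1]
  linarith

/-- The samples whose empirical measure is not uniformly within `ε` of `P` on half-lines. -/
def deviationEvent (n : ℕ) (P : Measure ℝ) (ε : ℝ) : Set (Fin n → ℝ) :=
  (⋃ a, upperTailExcess n P ε a) ∪ ⋃ a, lowerTailExcess n P ε a

theorem pi_deviationEvent_le {n : ℕ} (hn : 1 ≤ n) {ε : ℝ} (h₀ : 0 < ε)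
    (P : Measure ℝ) [IsProbabilityMeasure P] :
    (Measure.pi fun _ : Fin n => P) (deviationEvent n P ε)
      ≤ ENNReal.ofReal (2 * Real.exp (-(2 * n * ε ^ 2))) := by
  rw [two_mul, ENNReal.ofReal_add (Real.exp_pos _).le (Real.exp_pos _).le]
  exact (measure_union_le _ _).trans (add_le_add (pi_iUnion_upperTailExcess_le hn h₀ P)
    (pi_iUnion_lowerTailExcess_le hn h₀ P))

theorem measurableSet_of_mem_halfLines {S : Set ℝ} (hS : S ∈ halfLines) : MeasurableSet S := by
  obtain ⟨a, rfl | rfl⟩ := hS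
  · exact measurableSet_lt measurable_coe_real_ereal measurable_const
  · exact measurableSet_lt measurable_const measurable_coe_real_ereal

theorem Iio_mem_halfLines (a : ℝ) : Set.Iio a ∈ halfLines :=
  ⟨a, Or.inl (by ext; simp)⟩

theorem Ioi_mem_halfLines (a : ℝ) : Set.Ioi a ∈ halfLines :=
  ⟨a, Or.inr (by ext; simp)⟩

theorem mem_halfLines_cases {S : Set ℝ} (hS : S ∈ halfLines) :
    S = ∅ ∨ S = Set.univ ∨ (∃ a, S = Set.Iio a) ∨ ∃ a, S = Set.Ioi a := by
  obtain ⟨a, rfl | rfl⟩ := hS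
  · induction a with
    | bot => left; ext; simp
    | top => right; left; ext; simp
    | coe a => right; right; left; exact ⟨a, by ext; simp⟩
  · induction a with
    | bot => right; left; ext; simp
    | top => left; ext; simp
    | coe a => right; right; right; exact ⟨a, by ext; simp⟩

theorem abs_empirical_sub_real_le {n : ℕ} (hn : 1 ≤ n) {ε : ℝ} (h₀ : 0 ≤ ε)
    (P : Measure ℝ) [IsProbabilityMeasure P] {x : Fin n → ℝ} (hx : x ∉ deviationEvent n P ε)
    {S : Set ℝ} (hS : S ∈ halfLines) : |empirical x S - P.real S| ≤ ε := by
  have hup : ∀ a, empirical x (Set.Ici a) ≤ P.real (Set.Ici a) + ε := fun a =>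
    not_lt.1 fun h => hx (Or.inl (Set.mem_iUnion.2 ⟨a, h⟩))
  have hlo : ∀ a, empirical x (Set.Iic a) ≤ P.real (Set.Iic a) + ε := fun a =>
    not_lt.1 fun h => hx (Or.inr (Set.mem_iUnion.2 ⟨a, h⟩))
  rcases mem_halfLines_cases hS with rfl | rfl | ⟨a, rfl⟩ | ⟨a, rfl⟩
  · simpa [empirical_empty] using h₀
  · simpa [empirical_univ hn] using h₀
  · rw [abs_le]
    constructor
    · have h := hup a
      rw [← Set.compl_Iio, empirical_compl hn, probReal_compl_eq_one_sub measurableSet_Iio] at h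
      linarith
    -- The finitely many sample points below `a` lie in some `(-∞, b]` with `b < a`.
    · have hev : ∀ᶠ b in nhdsWithin a (Set.Iio a), ∀ i, x i < a → x i ≤ b := by
        refine Filter.eventually_all.2 fun i => ?_
        by_cases hi : x i < a
        · filter_upwards [eventually_nhdsWithin_of_eventually_nhds (lt_mem_nhds hi)] with b hb _
          exact hb.le
        · exact Filter.Eventually.of_forall fun b h => (hi h).elim
      obtain ⟨b, hb, hba⟩ := (hev.and self_mem_nhdsWithin).exists
      have h1 := empirical_le_empirical (x := x) (S := Set.Iio a) (T := Set.Iic b) hb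
      have h2 : P.real (Set.Iic b) ≤ P.real (Set.Iio a) :=
        measureReal_mono (Set.Iic_subset_Iio.2 hba)
      linarith [hlo b]
  · rw [abs_le]
    constructor
    · have h := hlo a
      rw [← Set.compl_Ioi, empirical_compl hn, probReal_compl_eq_one_sub measurableSet_Ioi] at h
      linarith
    · have hev : ∀ᶠ b in nhdsWithin a (Set.Ioi a), ∀ i, a < x i → b ≤ x i := by
        refine Filter.eventually_all.2 fun i => ?_
        by_cases hi : a < x i
        · filter_upwards [eventually_nhdsWithin_of_eventually_nhds (gt_mem_nhds hi)] with b hb _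
          exact hb.le
        · exact Filter.Eventually.of_forall fun b h => (hi h).elim
      obtain ⟨b, hb, hba⟩ := (hev.and self_mem_nhdsWithin).exists
      have h1 := empirical_le_empirical (x := x) (S := Set.Ioi a) (T := Set.Ici b) hb
      have h2 : P.real (Set.Ici b) ≤ P.real (Set.Ioi a) :=
        measureReal_mono (Set.Ici_subset_Ioi.2 hba)
      linarith [hup b]

end TradeoffTest

/-! ### Most powerful tests -/

namespace TradeoffTest

theorem integrable_of_forall_mem_Icc {P : Measure ℝ} [IsFiniteMeasure P] {φ : ℝ → ℝ}
    (hφ : Measurable φ) (h01 : ∀ x, φ x ∈ Set.Icc (0 : ℝ) 1) : Integrable φ P :=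
  Integrable.of_bound hφ.aestronglyMeasurable 1 (Filter.Eventually.of_forall fun x => by
    rw [Real.norm_eq_abs, abs_of_nonneg (h01 x).1]; exact (h01 x).2)

theorem bddBelow_typeTwoErrors {X : Type*} [MeasurableSpace X] (P Q : Measure X) (α : ℝ) :
    BddBelow {β : ℝ | ∃ φ : X → ℝ, Measurable φ ∧ (∀ x, φ x ∈ Set.Icc (0 : ℝ) 1) ∧
      ∫ x, φ x ∂P ≤ α ∧ β = ∫ x, (1 - φ x) ∂Q} := by
  refine ⟨0, ?_⟩
  rintro β ⟨φ, -, h01, -, rfl⟩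
  exact integral_nonneg fun x => sub_nonneg.2 (h01 x).2

theorem tradeoff_nonneg {X : Type*} [MeasurableSpace X] (P Q : Measure X) (α : ℝ) :
    0 ≤ tradeoff P Q α := by
  refine Real.sInf_nonneg ?_
  rintro β ⟨φ, -, h01, -, rfl⟩
  exact integral_nonneg fun x => sub_nonneg.2 (h01 x).2

theorem tradeoff_real_le_real_compl (P Q : Measure ℝ) [IsProbabilityMeasure P]
    [IsProbabilityMeasure Q] {S : Set ℝ} (hS : MeasurableSet S) :
    tradeoff P Q (P.real S) ≤ Q.real Sᶜ := by
  refine csInf_le (bddBelow_typeTwoErrors P Q _)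
    ⟨S.indicator fun _ => 1, measurable_const.indicator hS, fun x => ?_, ?_, ?_⟩
  · by_cases h : x ∈ S <;> simp [h]
  · rw [integral_indicator_const _ hS]; simp
  · have : ∀ x, 1 - S.indicator (fun _ => (1 : ℝ)) x = Sᶜ.indicator (fun _ => (1 : ℝ)) x := by
      intro x
      by_cases h : x ∈ S <;> simp [h]
    simp_rw [this]
    rw [integral_indicator_const _ hS.compl]; simp

theorem exists_test_of_tradeoff_lt {P Q : Measure ℝ} {α t : ℝ} (hα : 0 ≤ α)
    (h : tradeoff P Q α < t) : ∃ φ : ℝ → ℝ, Measurable φ ∧ (∀ x, φ x ∈ Set.Icc (0 : ℝ) 1) ∧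
      ∫ x, φ x ∂P ≤ α ∧ ∫ x, (1 - φ x) ∂Q < t := by
  have hne : {β : ℝ | ∃ φ : ℝ → ℝ, Measurable φ ∧ (∀ x, φ x ∈ Set.Icc (0 : ℝ) 1) ∧
      ∫ x, φ x ∂P ≤ α ∧ β = ∫ x, (1 - φ x) ∂Q}.Nonempty :=
    ⟨_, fun _ => 0, measurable_const, fun _ => by simp, by simpa using hα, rfl⟩
  obtain ⟨β, ⟨φ, h1, h2, h3, rfl⟩, h4⟩ := exists_lt_of_csInf_lt hne h
  exact ⟨φ, h1, h2, h3, h4⟩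

/-- If the likelihood ratio is at least `c` on `S`, then `c P ≤ Q` on `S`. -/
theorem smul_restrict_le_of_le_likelihoodRatio (P Q : Measure ℝ) [IsProbabilityMeasure P]
    [IsProbabilityMeasure Q] {S : Set ℝ} {c : NNReal}
    (h : ∀ᵐ x ∂(P + Q), x ∈ S → (c : ENNReal) ≤ likelihoodRatio P Q x) :
    c • P.restrict S ≤ Q.restrict S := by
  have hP : P ≪ P + Q := Measure.AbsolutelyContinuous.rfl.add_right Q
  have hQ : Q ≪ P + Q := by
    rw [add_comm]; exact Measure.AbsolutelyContinuous.rfl.add_right P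
  refine Measure.le_iff.2 fun B hB => ?_
  rw [Measure.smul_apply, Measure.restrict_apply hB, Measure.restrict_apply hB,
    ← Measure.setLIntegral_rnDeriv hP, ← Measure.setLIntegral_rnDeriv hQ, ENNReal.smul_def,
    smul_eq_mul, ← lintegral_const_mul _ (Measure.measurable_rnDeriv P (P + Q))]
  refine setLIntegral_mono_ae (Measure.measurable_rnDeriv Q (P + Q)).aemeasurable ?_
  filter_upwards [h, Measure.rnDeriv_lt_top P (P + Q)] with x hx hfin hxB
  exact ENNReal.mul_le_of_le_div (hx hxB.2)

theorem restrict_le_smul_of_likelihoodRatio_le (P Q : Measure ℝ) [IsProbabilityMeasure P]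
    [IsProbabilityMeasure Q] {S : Set ℝ} {c : NNReal}
    (h : ∀ᵐ x ∂(P + Q), x ∈ S → likelihoodRatio P Q x ≤ c) :
    Q.restrict S ≤ c • P.restrict S := by
  have hP : P ≪ P + Q := Measure.AbsolutelyContinuous.rfl.add_right Q
  have hQ : Q ≪ P + Q := by
    rw [add_comm]; exact Measure.AbsolutelyContinuous.rfl.add_right P
  refine Measure.le_iff.2 fun B hB => ?_
  rw [Measure.smul_apply, Measure.restrict_apply hB, Measure.restrict_apply hB,
    ← Measure.setLIntegral_rnDeriv hP, ← Measure.setLIntegral_rnDeriv hQ, ENNReal.smul_def,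
    smul_eq_mul, ← lintegral_const_mul _ (Measure.measurable_rnDeriv P (P + Q))]
  refine setLIntegral_mono_ae
    ((Measure.measurable_rnDeriv P (P + Q)).const_mul _).aemeasurable ?_
  filter_upwards [h, Measure.rnDeriv_lt_top P (P + Q)] with x hx hfin hxB
  have hq := hx hxB.2
  unfold likelihoodRatio at hq
  -- Where `p = 0`, a finite value of `q / p` forces `q = 0`.
  by_cases hp : P.rnDeriv (P + Q) x = 0
  · rw [hp] at hq ⊢
    by_cases hq0 : Q.rnDeriv (P + Q) x = 0
    · simp [hq0]
    · rw [ENNReal.div_zero hq0] at hq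
      exact absurd hq (by simp)
  · exact (ENNReal.div_le_iff hp hfin.ne).1 hq

/-- Neyman–Pearson lemma: the likelihood ratio test `S` is at least as powerful as any test `φ`
of no larger size. -/
theorem real_compl_le_integral_of_likelihoodRatio_test (P Q : Measure ℝ) [IsProbabilityMeasure P]
    [IsProbabilityMeasure Q] {S : Set ℝ} (hS : MeasurableSet S) {c : NNReal}
    (hge : ∀ᵐ x ∂(P + Q), x ∈ S → (c : ENNReal) ≤ likelihoodRatio P Q x)
    (hle : ∀ᵐ x ∂(P + Q), x ∈ Sᶜ → likelihoodRatio P Q x ≤ c)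
    {φ : ℝ → ℝ} (hφ : Measurable φ) (h01 : ∀ x, φ x ∈ Set.Icc (0 : ℝ) 1)
    (hsize : ∫ x, φ x ∂P ≤ P.real S) : Q.real Sᶜ ≤ ∫ x, (1 - φ x) ∂Q := by
  have hφ' : Measurable fun x => 1 - φ x := hφ.const_sub 1
  have h01' : ∀ x, 1 - φ x ∈ Set.Icc (0 : ℝ) 1 := fun x =>
    ⟨by linarith [(h01 x).2], by linarith [(h01 x).1]⟩
  have h1 : (c : ℝ) * ∫ x in S, (1 - φ x) ∂P ≤ ∫ x in S, (1 - φ x) ∂Q := by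
    have := integral_mono_measure (smul_restrict_le_of_le_likelihoodRatio P Q hge)
      (Filter.Eventually.of_forall fun x => (h01' x).1) (integrable_of_forall_mem_Icc hφ' h01')
    rwa [integral_smul_nnreal_measure] at this
  have h2 : ∫ x in Sᶜ, φ x ∂Q ≤ (c : ℝ) * ∫ x in Sᶜ, φ x ∂P := by
    have := integral_mono_measure (restrict_le_smul_of_likelihoodRatio_le P Q hle)
      (Filter.Eventually.of_forall fun x => (h01 x).1) (integrable_of_forall_mem_Icc hφ h01)
    rwa [integral_smul_nnreal_measure] at this
  have hsub : ∀ (μ : Measure ℝ) [IsProbabilityMeasure μ] (T : Set ℝ),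
      ∫ x in T, (1 - φ x) ∂μ = μ.real T - ∫ x in T, φ x ∂μ := by
    intro μ _ T
    rw [integral_sub (integrable_const _) (integrable_of_forall_mem_Icc hφ h01)]
    simp
  have hsplitP := integral_add_compl hS (integrable_of_forall_mem_Icc (P := P) hφ h01)
  have hsplitQ := integral_add_compl hS (integrable_of_forall_mem_Icc (P := Q) hφ' h01')
  rw [hsub P] at h1
  have h3 := hsub Q Sᶜ
  have h4 : 0 ≤ (c : ℝ) * (P.real S - ∫ x, φ x ∂P) :=
    mul_nonneg c.2 (sub_nonneg.2 hsize)
  rw [← hsplitP] at h4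
  linarith

theorem exists_real_Iio_eq (P : Measure ℝ) [IsProbabilityMeasure P] [NullSingletonClass P] {α : ℝ}
    (h₀ : 0 < α) (h₁ : α < 1) : ∃ a, P.real (Set.Iio a) = α := by
  have hcont : Continuous (ProbabilityTheory.cdf P) := by
    refine continuous_iff_continuousAt.2 fun x => ?_
    rw [(ProbabilityTheory.cdf P).mono.continuousAt_iff_leftLim_eq_rightLim,
      StieltjesFunction.rightLim_eq]
    have h := (ProbabilityTheory.cdf P).measure_singleton x
    rw [ProbabilityTheory.measure_cdf, measure_singleton] at h
    have h' := ENNReal.ofReal_eq_zero.1 h.symm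
    exact le_antisymm ((ProbabilityTheory.cdf P).mono.leftLim_le le_rfl) (by linarith)
  obtain ⟨a, ha⟩ := mem_range_of_exists_le_of_exists_ge hcont
    ((ProbabilityTheory.tendsto_cdf_atBot P).eventually_le_const h₀).exists
    ((ProbabilityTheory.tendsto_cdf_atTop P).eventually_const_le h₁).exists
  refine ⟨a, ?_⟩
  rw [measureReal_congr Iio_ae_eq_Iic, ← ProbabilityTheory.cdf_eq_real, ha]

/-- For a pair with monotone likelihood ratio, the half-line of size `α ∈ (0, 1)` on the side where
the likelihood ratio is large is a most powerful test. -/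
theorem exists_halfLine_mostPowerful {P Q : ProbabilityMeasure ℝ} (hPQ : (P, Q) ∈ mlrPairs)
    {α : ℝ} (h₀ : 0 < α) (h₁ : α < 1) {φ : ℝ → ℝ} (hφ : Measurable φ)
    (h01 : ∀ x, φ x ∈ Set.Icc (0 : ℝ) 1) (hsize : ∫ x, φ x ∂(P : Measure ℝ) ≤ α) :
    ∃ S ∈ halfLines, (P : Measure ℝ).real S = α ∧
      (Q : Measure ℝ).real Sᶜ ≤ ∫ x, (1 - φ x) ∂(Q : Measure ℝ) := by
  obtain ⟨hP, hQ, L, hL, hLae⟩ := hPQ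
  simp only at hP hQ hLae
  -- An infinite threshold would make the half-line beyond it `P`-null.
  have hnull : ∀ S : Set ℝ, (∀ x ∈ S, L x = ⊤) →
      (P : Measure ℝ).real S = 0 := by
    intro S htop
    have hle : ∀ k : ℕ, (k : ℝ) * (P : Measure ℝ).real S ≤ 1 := by
      intro k
      have h := smul_restrict_le_of_le_likelihoodRatio (P : Measure ℝ) Q (S := S) (c := k) (by
        filter_upwards [hLae] with x hx hxS
        rw [← hx, htop x hxS]
        exact le_top)
      have h' := ENNReal.toReal_mono (measure_ne_top _ _) (h S)
      rw [Measure.smul_apply, Measure.restrict_apply_self, Measure.restrict_apply_self,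
        ENNReal.smul_def, smul_eq_mul, ENNReal.toReal_mul] at h'
      have h'' : (Q : Measure ℝ).real S ≤ 1 := measureReal_le_one
      exact le_trans (by simpa [Measure.real] using h') h''
    by_contra hne
    have hpos : 0 < (P : Measure ℝ).real S := lt_of_le_of_ne measureReal_nonneg (Ne.symm hne)
    obtain ⟨k, hk⟩ := exists_nat_gt (1 / (P : Measure ℝ).real S)
    rw [div_lt_iff₀ hpos] at hk
    linarith [hle k]
  suffices h : ∃ (S : Set ℝ) (a : ℝ), S ∈ halfLines ∧ (P : Measure ℝ).real S = α ∧
      (∀ x ∈ S, L a ≤ L x) ∧ ∀ x ∈ Sᶜ, L x ≤ L a by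
    obtain ⟨S, a, hS, hPS, hge, hle⟩ := h
    have hSm := measurableSet_of_mem_halfLines hS
    have hfin : L a ≠ ⊤ := by
      intro htop
      have := hnull S fun x hx => top_le_iff.1 (htop ▸ hge x hx)
      linarith
    refine ⟨S, hS, hPS, real_compl_le_integral_of_likelihoodRatio_test (P : Measure ℝ) Q hSm
      (c := (L a).toNNReal) ?_ ?_ hφ h01 (hsize.trans hPS.ge)⟩
    · filter_upwards [hLae] with x hx hxS
      rw [ENNReal.coe_toNNReal hfin, ← hx]
      exact hge x hxS
    · filter_upwards [hLae] with x hx hxS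
      rw [ENNReal.coe_toNNReal hfin, ← hx]
      exact hle x hxS
  rcases hL with hL | hL
  · obtain ⟨a, ha⟩ := exists_real_Iio_eq (P : Measure ℝ) (α := 1 - α) (by linarith) (by linarith)
    refine ⟨Set.Ioi a, a, Ioi_mem_halfLines a, ?_, fun x hx => hL (le_of_lt hx),
      fun x hx => hL (by simpa using hx)⟩
    rw [measureReal_congr Iio_ae_eq_Iic] at ha
    rw [← Set.compl_Iic, probReal_compl_eq_one_sub measurableSet_Iic, ha]
    ring
  · obtain ⟨a, ha⟩ := exists_real_Iio_eq (P : Measure ℝ) h₀ h₁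
    exact ⟨Set.Iio a, a, Iio_mem_halfLines a, ha, fun x hx => hL (le_of_lt hx),
      fun x hx => hL (by simpa using hx)⟩

/-! ### Error bounds for the scan test -/

theorem margin_pos {n : ℕ} (hn : 1 ≤ n) {δ : ℝ} (h₀ : 0 < δ) (h₁ : δ < 1) : 0 < margin n δ := by
  have hn0 : (0 : ℝ) < n := by exact_mod_cast hn
  have : 0 < Real.log (4 / δ) := Real.log_pos (by rw [lt_div_iff₀ h₀]; linarith)
  exact Real.sqrt_pos.2 (by positivity)

theorem two_mul_exp_neg_margin_sq {n : ℕ} (hn : 1 ≤ n) {δ : ℝ} (h₀ : 0 < δ) (h₁ : δ < 1) :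
    2 * Real.exp (-(2 * n * margin n δ ^ 2)) = δ / 2 := by
  have hn0 : (0 : ℝ) < n := by exact_mod_cast hn
  have : 0 < Real.log (4 / δ) := Real.log_pos (by rw [lt_div_iff₀ h₀]; linarith)
  have h2 : 2 * n * margin n δ ^ 2 = Real.log (4 / δ) := by
    rw [margin, Real.sq_sqrt (by positivity)]
    field_simp
  rw [h2, Real.exp_neg, Real.exp_log (by positivity)]
  field_simp
  norm_num

/-- A region contained in the event that one of the two samples deviates has probability at most
`δ`, half of which comes from each sample. -/
theorem sampleLaw_le_of_subset_deviation {n : ℕ} (hn : 1 ≤ n) {δ : ℝ} (h₀ : 0 < δ) (h₁ : δ < 1)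
    (P Q : ProbabilityMeasure ℝ) {R : Set ((Fin n → ℝ) × (Fin n → ℝ))}
    (hR : ∀ xy ∈ R, xy.1 ∈ deviationEvent n (P : Measure ℝ) (margin n δ) ∨
      xy.2 ∈ deviationEvent n (Q : Measure ℝ) (margin n δ)) :
    sampleLaw n P Q R ≤ ENNReal.ofReal δ := by
  have hη := margin_pos hn h₀ h₁
  have hsub : R ⊆ deviationEvent n (P : Measure ℝ) (margin n δ) ×ˢ Set.univ
      ∪ Set.univ ×ˢ deviationEvent n (Q : Measure ℝ) (margin n δ) := fun xy hxy =>
    (hR xy hxy).imp (fun h => ⟨h, trivial⟩) fun h => ⟨trivial, h⟩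
  refine (measure_mono hsub).trans ((measure_union_le _ _).trans ?_)
  have hdev : ∀ μ : ProbabilityMeasure ℝ, (Measure.pi fun _ : Fin n => (μ : Measure ℝ))
      (deviationEvent n (μ : Measure ℝ) (margin n δ)) ≤ ENNReal.ofReal (δ / 2) := fun μ =>
    two_mul_exp_neg_margin_sq hn h₀ h₁ ▸ pi_deviationEvent_le hn hη (μ : Measure ℝ)
  rw [sampleLaw, Measure.prod_prod, Measure.prod_prod, measure_univ, measure_univ, mul_one,
    one_mul]
  refine (add_le_add (hdev P) (hdev Q)).trans_eq ?_
  rw [← ENNReal.ofReal_add (by linarith) (by linarith), add_halves]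

end TradeoffTest

theorem mainTheorem5 (n : ℕ) (hn : 1 ≤ n) (δ : ℝ) (hδ₀ : 0 < δ) (hδ₁ : δ < 1) (f₀ f₁ : ℝ → ℝ)
    (hf₀ : TradeoffTest.IsTradeoffFunction f₀) (hf₁ : TradeoffTest.IsTradeoffFunction f₁) :
    TradeoffTest.typeOneError Set.univ f₀ (TradeoffTest.scanTest n δ f₀) ≤ ENNReal.ofReal δ ∧
    ((∀ α ∈ Set.Icc (0 : ℝ) 1,
        f₁ α ≤ max (TradeoffTest.extend f₀ (α + 2 * TradeoffTest.margin n δ)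
          - 2 * TradeoffTest.margin n δ) 0) →
      TradeoffTest.typeTwoError TradeoffTest.mlrPairs f₁ (TradeoffTest.scanTest n δ f₀)
        ≤ ENNReal.ofReal δ) := by
  have hη := TradeoffTest.margin_pos hn hδ₀ hδ₁
  constructor
  · refine iSup₂_le fun P Q => iSup₂_le fun _ hdom => ?_
    refine TradeoffTest.sampleLaw_le_of_subset_deviation hn hδ₀ hδ₁ P Q ?_
    rintro ⟨x, y⟩ ⟨S, hS, hrej⟩
    simp only at hrej ⊢
    by_contra! hgood
    set η := TradeoffTest.margin n δ
    have hSm := TradeoffTest.measurableSet_of_mem_halfLines hS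
    have hx := abs_le.1
      (TradeoffTest.abs_empirical_sub_real_le hn hη.le (P : Measure ℝ) hgood.1 hS)
    have hy := abs_le.1
      (TradeoffTest.abs_empirical_sub_real_le hn hη.le (Q : Measure ℝ) hgood.2 hS)
    have hdomS := hdom ((P : Measure ℝ).real S) ⟨measureReal_nonneg, measureReal_le_one⟩
    have hT := TradeoffTest.tradeoff_real_le_real_compl (P : Measure ℝ) (Q : Measure ℝ) hSm
    have hle : TradeoffTest.extend f₀ (TradeoffTest.empirical x S + η)
        ≤ f₀ ((P : Measure ℝ).real S) := by
      unfold TradeoffTest.extend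
      split_ifs with h
      · exact hf₀.antitone ⟨measureReal_nonneg, measureReal_le_one⟩
          ⟨by linarith [TradeoffTest.empirical_nonneg x S], h⟩ (by linarith)
      · exact hf₀.nonneg _ ⟨measureReal_nonneg, measureReal_le_one⟩
    rw [TradeoffTest.empirical_compl hn] at hrej
    rw [probReal_compl_eq_one_sub hSm] at hT
    linarith
  · intro hf
    refine iSup₂_le fun P Q => iSup₂_le fun hPQ hdom => ?_
    refine TradeoffTest.sampleLaw_le_of_subset_deviation hn hδ₀ hδ₁ P Q ?_
    set η := TradeoffTest.margin n δ with hηdef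
    obtain ⟨α, hα, hlt⟩ : ∃ α ∈ Set.Icc (0 : ℝ) 1,
        TradeoffTest.tradeoff (P : Measure ℝ) Q α < f₁ α := by
      simpa only [TradeoffTest.Dominates, not_forall, not_le, exists_prop] using hdom
    have hT0 := TradeoffTest.tradeoff_nonneg (P : Measure ℝ) (Q : Measure ℝ) α
    have hlt' : TradeoffTest.tradeoff (P : Measure ℝ) Q α
        < TradeoffTest.extend f₀ (α + 2 * η) - 2 * η :=
      (lt_max_iff.1 (hlt.trans_le (hf α hα))).resolve_right (by linarith)
    have hα1 : α + 2 * η < 1 := by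
      by_contra! h
      unfold TradeoffTest.extend at hlt'
      split_ifs at hlt' with h'
      · have := hf₀.le_one_sub (α + 2 * η) ⟨by linarith [hα.1], h'⟩
        linarith
      · linarith
    rw [TradeoffTest.extend, if_pos hα1.le] at hlt'
    obtain ⟨φ, hφ, h01, hsize, hpow⟩ := TradeoffTest.exists_test_of_tradeoff_lt hα.1 hlt'
    -- By continuity of `f₀` the size can be raised slightly, which rules out size `0`, where a
    -- likelihood ratio threshold may have to be infinite.
    obtain ⟨α', hαα', hα'1, hpow'⟩ : ∃ α', α < α' ∧ α' + 2 * η < 1 ∧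
        ∫ x, (1 - φ x) ∂(Q : Measure ℝ) < f₀ (α' + 2 * η) - 2 * η := by
      have hc : ContinuousAt (fun t => f₀ (t + 2 * η)) α := by
        have : ContinuousAt f₀ (α + 2 * η) :=
          hf₀.continuous.continuousAt (Icc_mem_nhds (by linarith [hα.1]) hα1)
        exact this.comp (f := fun t => t + 2 * η) (by fun_prop)
      have hev : ∀ᶠ t in nhds α, ∫ x, (1 - φ x) ∂(Q : Measure ℝ) + 2 * η < f₀ (t + 2 * η) :=
        hc.eventually (lt_mem_nhds (by linarith))
      have hev1 : ∀ᶠ t in nhds α, t < 1 - 2 * η := gt_mem_nhds (by linarith)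
      obtain ⟨t, ⟨ht, ht1⟩, hαt⟩ := ((eventually_nhdsWithin_of_eventually_nhds
        (hev.and hev1)).and (self_mem_nhdsWithin (s := Set.Ioi α))).exists
      exact ⟨t, hαt, by linarith, by linarith⟩
    obtain ⟨S, hS, hPS, hQS⟩ := TradeoffTest.exists_halfLine_mostPowerful hPQ (α := α')
      (by linarith [hα.1]) (by linarith) hφ h01 (hsize.trans hαα'.le)
    rintro ⟨x, y⟩ hacc
    simp only
    by_contra! hgood
    have hSm := TradeoffTest.measurableSet_of_mem_halfLines hS
    have hx := abs_le.1
      (TradeoffTest.abs_empirical_sub_real_le hn hη.le (P : Measure ℝ) hgood.1 hS)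
    have hy := abs_le.1
      (TradeoffTest.abs_empirical_sub_real_le hn hη.le (Q : Measure ℝ) hgood.2 hS)
    refine hacc ⟨S, hS, ?_⟩
    simp only [← hηdef]
    have h1 : TradeoffTest.empirical x S + η ≤ α' + 2 * η := by linarith
    have h0 : 0 ≤ TradeoffTest.empirical x S + η := by
      linarith [TradeoffTest.empirical_nonneg x S]
    have hmono := hf₀.antitone ⟨h0, h1.trans hα'1.le⟩ ⟨h0.trans h1, hα'1.le⟩ h1
    rw [TradeoffTest.extend, if_pos (h1.trans hα'1.le), TradeoffTest.empirical_compl hn]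
    rw [probReal_compl_eq_one_sub hSm] at hQS
    linarith
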